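/- Let $G=(V,E)$ be a finite acyclic directed graph (parallel edges, called channels, are allowed and have unit capacity) with a source node $s$ and a finite set $T\subseteq V\setminus\{s\}$ of sink nodes, such that $s$ has no incoming channels and sinks have no outgoing channels. Let $In(i)$ be the set of channels with head $i$, except that $In(s)=\{d_1',\dots,d_w'\}$ consists of $w$ imaginary message channels, where $w\ge 0$ is the information rate. Let $C_t$ be the minimum cut capacity between $s$ and $t$, and let $\delta_t=C_t-w$. Let $\mathcal F$ be a field. A linear network code is a choice of local encoding coefficients $k_{d,e}\in\mathcal F$ for all $e\in E$ and $d\in In(\mathrm{tail}(e))$. Its extended global encoding kernels are the column vectors over $\mathcal F$ indexed by $In(s)\cup E$ given by $\tilde f_{d_i'}=1_{d_i'}$ and $$\tilde f_e=\sum_{d\in In(\mathrm{tail}(e))}k_{d,e}\tilde f_d+1_e\qquad(e\in E),$$ where $1_d$ denotes the unit vector at $d$. For $t\in T$ put $\tilde F_t=(\tilde f_e: e\in In(t))$, $\Phi(t)=\{(X,0)\tilde F_t: X\in\mathcal F^w\}$ and, for an error pattern $\rho\subseteq E$, $\Delta(t,\rho)=\{(0,Z)\tilde F_t: Z\in\mathcal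 F^{E},\ Z_e=0\text{ for all }e\notin\rho\}$. The rank $rank_t(\rho)$ is the least $|\rho'|$ over the error patterns $\rho'$ with $\Delta(t,\rho)\subseteq\Delta(t,\rho')$ for every linear network code. For $b\ge 0$ let $R_t(b)=\{\rho\subseteq E:|\rho|=rank_t(\rho)=b\}$. A code is called regular if $\dim\Phi(t)=w$ for all $t\in T$, and its minimum distance at $t$ is $d_{\min}^{(t)}=\min\{rank_t(\rho):\dim(\Delta(t,\rho)\cap\Phi(t))>0\}$ (with $\min\emptyset=\infty$, which for regular codes occurs only if $w=0$). Theorem. Let $\beta_t$ $(t\in T)$ be nonnegative integers with $\beta_t\le\delta_t$ for each $t\in T$. If $|\mathcal F|\ge\sum_{t\in T}|R_t(\beta_t)|$, then there exists a regular linear network error correction code over $\mathcal F$ such that $d_{\min}^{(t)}\ge\beta_t+1$ for all $t\in T$. -/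

import Mathlib

open scoped Classical

noncomputable section

/-- A single-source acyclic network: nodes `V`, channels `E` (parallel channels are allowed, all of
unit capacity).  The source is not a sink, it has no incoming channels, and sinks have no outgoing
channels. -/
structure Network (V E : Type*) where
  tail : E → V
  head : E → V
  source : V
  sinks : Finset V
  source_notMem_sinks : source ∉ sinks
  head_ne_source : ∀ e, head e ≠ source
  tail_notMem_sinks : ∀ e, tail e ∉ sinks
  acyclic : ∀ i, ¬ Relation.TransGen (fun a b => ∃ e, tail e = a ∧ head e = b) i i

namespace Network

variable {V E : Type*} (N : Network V E)

/-- A path from node `i` to node `j`: a nonempty sequence of channels `(e₁, …, eₘ)` with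
`tail e₁ = i`, `head eₘ = j` and `tail eₖ₊₁ = head eₖ`. -/
def IsPath (i j : V) (p : List E) : Prop :=
  p.IsChain (fun d e => N.tail e = N.head d) ∧
    ∃ hp : p ≠ [], N.tail (p.head hp) = i ∧ N.head (p.getLast hp) = j

/-- A set of channels whose removal disconnects `i` from `j`. -/
def IsCut (i j : V) (C : Finset E) : Prop :=
  ∀ p : List E, N.IsPath i j p → ∃ e ∈ p, e ∈ C

/-- The minimum cut capacity between the source and the node `t`. -/
def minCut (t : V) : ℕ :=
  sInf {n | ∃ C : Finset E, N.IsCut N.source t C ∧ C.card = n}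

/-- The redundancy `C_t - w` of the node `t` at information rate `w`. -/
def redundancy (w : ℕ) (t : V) : ℤ := (N.minCut t : ℤ) - w

/-- The channel `d` enters the tail of the channel `e`. -/
def Adj (d e : E) : Prop := N.head d = N.tail e

theorem transGen_of_adj {d e : E} (h : Relation.TransGen N.Adj d e) :
    Relation.TransGen (fun a b => ∃ c, N.tail c = a ∧ N.head c = b) (N.tail d) (N.tail e) := by
  induction h with
  | single h => exact .single ⟨d, rfl, h⟩
  | tail _ h ih => exact ih.tail ⟨_, rfl, h⟩

theorem adj_wellFounded [Finite E] : WellFounded N.Adj := by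
  have : IsTrans E (Relation.TransGen N.Adj) := ⟨fun _ _ _ => Relation.TransGen.trans⟩
  have : Std.Irrefl (Relation.TransGen N.Adj) :=
    ⟨fun e h => N.acyclic _ (N.transGen_of_adj h)⟩
  exact Subrelation.wf (fun h => Relation.TransGen.single h)
    (Finite.wellFounded_of_trans_of_irrefl (Relation.TransGen N.Adj))

variable [Fintype E]

/-- The incoming channels of a node: the real ones (`Sum.inr d` with `head d = i`) and, at the
source, the `w` imaginary message channels (`Sum.inl j`). -/
def inChannels (w : ℕ) (i : V) : Finset (Fin w ⊕ E) :=
  Finset.univ.filter (Sum.elim (fun _ => i = N.source) (fun d => N.head d = i))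

/-- A linear network code of rate `w` over `F`, given by its local encoding coefficients `k d e`.
Only the entries with `d ∈ In(tail e)` are used, so that these entries form the local encoding
kernels of the nodes. -/
abbrev Code (_N : Network V E) (F : Type*) (w : ℕ) : Type _ := (Fin w ⊕ E) → E → F

section Code

variable {F : Type*} [Field F] {w : ℕ} (k : N.Code F w)

/-- The extended global encoding kernels of the real channels, by recursion along the network.
See `extKernel_inr` for the recursive formula. -/
def chanKernel : E → (Fin w ⊕ E) → F :=
  N.adj_wellFounded.fix fun e rec =>
    ∑ d ∈ N.inChannels w (N.tail e),
        k d e • (match d with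
          | Sum.inl i => Pi.single (Sum.inl i) (1 : F)
          | Sum.inr c => if h : N.Adj c e then rec c h else 0)
      + Pi.single (Sum.inr e) 1

/-- The extended global encoding kernels of the imaginary message channels (unit vectors) and of
the real channels, as vectors indexed by `In(s) ∪ E`. -/
def extKernel : (Fin w ⊕ E) → (Fin w ⊕ E) → F
  | Sum.inl i => Pi.single (Sum.inl i) 1
  | Sum.inr e => N.chanKernel k e

/-- `f_e = ∑_{d ∈ In(tail e)} k_{d,e} f_d + 1_e`. -/
theorem extKernel_inr (e : E) :
    N.extKernel k (Sum.inr e) =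
      ∑ d ∈ N.inChannels w (N.tail e), k d e • N.extKernel k d + Pi.single (Sum.inr e) 1 := by
  change N.chanKernel k e = _
  rw [chanKernel, WellFounded.fix_eq]
  congr 1
  refine Finset.sum_congr rfl fun d hd => ?_
  rcases d with i | c
  · rfl
  · have h : N.Adj c e := by simpa [inChannels, Adj] using hd
    simp only [h, dite_true]
    rfl

/-- The decoding matrix `(f_e : e ∈ In(t))` at a sink `t`. -/
def decodingMatrix (t : V) : Matrix (Fin w ⊕ E) {e : E // N.head e = t} F :=
  Matrix.of fun d e => N.extKernel k (Sum.inr e.1) d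

/-- The message space `Φ(t)`: all `(X, 0) * decodingMatrix t`. -/
def messageSpace (t : V) : Submodule F ({e : E // N.head e = t} → F) where
  carrier := {y | ∃ X : Fin w → F,
    Matrix.vecMul (Sum.elim X (0 : E → F)) (N.decodingMatrix k t) = y}
  zero_mem' := ⟨0, by simp⟩
  add_mem' := by
    rintro _ _ ⟨X, rfl⟩ ⟨Y, rfl⟩
    refine ⟨X + Y, ?_⟩
    rw [← Matrix.add_vecMul]
    congr 1
    ext (i | i) <;> simp
  smul_mem' := by
    rintro c _ ⟨X, rfl⟩
    refine ⟨c • X, ?_⟩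
    rw [← Matrix.smul_vecMul]
    congr 1
    ext (i | i) <;> simp

/-- The error space `Δ(t, ρ)`: all `(0, Z) * decodingMatrix t` with `Z` matching the error
pattern `ρ`. -/
def errorSpace (t : V) (ρ : Finset E) : Submodule F ({e : E // N.head e = t} → F) where
  carrier := {y | ∃ Z : E → F, (∀ e, e ∉ ρ → Z e = 0) ∧
    Matrix.vecMul (Sum.elim (0 : Fin w → F) Z) (N.decodingMatrix k t) = y}
  zero_mem' := ⟨0, by simp, by simp⟩
  add_mem' := by
    rintro _ _ ⟨X, hX, rfl⟩ ⟨Y, hY, rfl⟩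
    refine ⟨X + Y, fun e he => by simp [hX e he, hY e he], ?_⟩
    rw [← Matrix.add_vecMul]
    congr 1
    ext (i | i) <;> simp
  smul_mem' := by
    rintro c _ ⟨X, hX, rfl⟩
    refine ⟨c • X, fun e he => by simp [hX e he], ?_⟩
    rw [← Matrix.smul_vecMul]
    congr 1
    ext (i | i) <;> simp

end Code

variable (F : Type*) [Field F] (w : ℕ)

/-- The error pattern `ρ₁` is dominated by `ρ₂` with respect to `t`: the inclusion of the error
spaces holds for every linear network code. -/
def Dominated (t : V) (ρ₁ ρ₂ : Finset E) : Prop :=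
  ∀ k : N.Code F w, N.errorSpace k t ρ₁ ≤ N.errorSpace k t ρ₂

/-- The rank of an error pattern with respect to `t`: the least size of an error pattern that
dominates it. -/
def patternRank (t : V) (ρ : Finset E) : ℕ :=
  sInf {n | ∃ ρ' : Finset E, N.Dominated F w t ρ ρ' ∧ ρ'.card = n}

/-- `R_t(b)`: the set of error patterns of size and rank `b`. -/
def fullRankPatterns (t : V) (b : ℕ) : Finset (Finset E) :=
  Finset.univ.filter fun ρ => ρ.card = b ∧ N.patternRank F w t ρ = b

variable {F w}

/-- A code is regular if `dim Φ(t) = w` at every sink. -/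
def IsRegular (k : N.Code F w) : Prop :=
  ∀ t ∈ N.sinks, Module.finrank F (N.messageSpace k t) = w

/-- The minimum distance `min {rank_t(ρ) : dim (Δ(t, ρ) ∩ Φ(t)) > 0}` at `t`.  (It is valued in
`ℕ∞` only because the set is empty in the degenerate case `w = 0`; for a regular code with `w ≥ 1`
it is nonempty.) -/
def minDist (k : N.Code F w) (t : V) : ℕ∞ :=
  sInf {n : ℕ∞ | ∃ ρ : Finset E,
    0 < Module.finrank F ↥(N.errorSpace k t ρ ⊓ N.messageSpace k t) ∧
      n = (N.patternRank F w t ρ : ℕ∞)}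

end Network

end

/-!
Write `y = x * M` for the vector of symbols carried by all channels, imaginary ones included, on
input `x` (messages and errors). It is the unique solution of `y_e = ∑ k_{d,e} y_d + x_e`
(`eq_transfer`).

*Combinatorics.* Let `A` be a set of channels. Channel-disjoint paths from the members of `A` to a
sink `t` amount to an injection `φ` of the set of channels into itself, which off `A` moves a
channel to one of its predecessors or fixes it, and maps `A` into `In(t)` (`IsLinkage`). Hall's
theorem gives such a `φ` as soon as no set with fewer than `|A|` members separates `A` from `t`
(`exists_isLinkage`). A set separating an error pattern `ρ` from `t` dominates `ρ`
(`IsBarrier.dominated`). So, for `ρ` of full rank, all of `ρ` together with `w` messages can be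
linked to `t` provided that `w + |ρ| ≤ C_t` (`exists_isLinkage_univ_disjSum`). Replacing messages
by the first channels on their paths shows moreover that `ρ` extends to a linked pattern of any size
up to `C_t` (`exists_superset_isLinkage`).

*Algebra.* Given at most `|F|` linkages, a single code makes all of them effective: an input
supported on `A` is determined by what arrives at `t` (`exists_code_realizes`,
`Realizes.eq_zero`). The coefficients are chosen channel by channel. Initially the vectors `y` are
tested by the coordinate functionals `y ↦ y (φ v)`, which separate points since `φ` is surjective;
processing a channel `v` outside `A` replaces `y (φ v)` by `y v - ∑ k_{d,v} y d`. For each linkage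
the functionals keep separating points unless the coefficients lie in one proper *linear*
hyperplane, and at most `|F|` of those do not cover the space. That the hyperplanes are linear, not
just affine, is what makes `|F|` as large as the number of linkages sufficient.

Applied to a single linkage, this shows that linked patterns have full rank, whence every pattern of
rank at most `b ≤ C_t` is dominated by a member of `R_t(b)` (`exists_mem_fullRankPatterns`). Applied
to the linkages of `In(s) ∪ ρ` for all sinks `t` and all `ρ ∈ R_t(β_t)`, it gives the code: at each
`t` the message and an error on `ρ` are determined by the received word, so `Φ(t)` has dimension `w`
and meets `Δ(t, ρ)` trivially; by domination the same holds for every pattern of rank at most `β_t`.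
-/

/-! ### Avoiding finitely many hyperplanes -/

/-- At most `|F|` nonzero linear functionals over a field `F` have a common point at which none of
them vanishes.  If `x` serves for all functionals but `f j`, and `f j x = 0`, take `y + c • x` with
`f j y ≠ 0`: each of the other functionals excludes just one value of `c`. -/
theorem exists_forall_apply_ne_zero {F M ι : Type*} [Field F] [AddCommGroup M] [Module F M]
    (s : Finset ι) (f : ι → M →ₗ[F] F) (hf : ∀ i ∈ s, f i ≠ 0)
    (hs : (s.card : ℕ∞) ≤ ENat.card F) : ∃ x, ∀ i ∈ s, f i x ≠ 0 := by
  induction s using Finset.induction_on with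
  | empty => exact ⟨0, by simp⟩
  | insert j s hj ih =>
    rw [Finset.card_insert_of_notMem hj] at hs
    obtain ⟨x, hx⟩ := ih (fun i hi => hf i (Finset.mem_insert_of_mem hi))
      (le_trans (by exact_mod_cast Nat.le_succ _) hs)
    by_cases hjx : f j x = 0
    · obtain ⟨y, hy⟩ : ∃ y, f j y ≠ 0 := by
        by_contra! h
        exact hf j (Finset.mem_insert_self _ _) (LinearMap.ext h)
      obtain ⟨c, hc⟩ : ∃ c, c ∉ s.image fun i => -(f i y) / f i x := by
        by_contra! h
        have huniv : ((s.image fun i => -(f i y) / f i x : Finset F) : Set F) = Set.univ :=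
          Set.eq_univ_of_forall fun c => by simpa using h c
        have hcard : ENat.card F ≤ (s.card : ℕ∞) := by
          rw [← Set.encard_univ, ← huniv, Set.encard_coe_eq_coe_finsetCard]
          exact_mod_cast Finset.card_image_le
        have := hs.trans hcard
        norm_cast at this
        omega
      refine ⟨y + c • x, fun i hi => ?_⟩
      rcases Finset.mem_insert.1 hi with rfl | hi
      · simpa [hjx] using hy
      · intro h0
        refine hc (Finset.mem_image.2 ⟨i, hi, ?_⟩)
        rw [div_eq_iff (hx i hi)]
        simp only [map_add, map_smul, smul_eq_mul] at h0
        linear_combination -h0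
    · refine ⟨x, fun i hi => ?_⟩
      rcases Finset.mem_insert.1 hi with rfl | hi
      exacts [hjx, hx i hi]

namespace Network

variable {V E : Type*} (N : Network V E)

/-! ### Barriers and cuts -/

/-- `S` consists of channels outside `ρ` such that every channel into `t`, and every channel feeding
into a member of `S`, lies in `D` or `S`.
Hence whatever reaches `t` from `ρ` passes through `D`. -/
structure IsBarrier (t : V) (ρ D S : Finset E) : Prop where
  disjoint : Disjoint S ρ
  head : ∀ e, N.head e = t → e ∈ D ∪ S
  adj : ∀ e ∈ S, ∀ d, N.Adj d e → d ∈ D ∪ S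

/-- A barrier in which no channel of `S` leaves the source gives a cut. -/
theorem IsBarrier.minCut_le {N : Network V E} {t : V} {ρ D S : Finset E}
    (h : N.IsBarrier t ρ D S)
    (hs : ∀ e ∈ S, N.tail e ≠ N.source) : N.minCut t ≤ D.card := by
  refine Nat.sInf_le ⟨D, ?_, rfl⟩
  rintro p ⟨hc, hp, hhead, hlast⟩
  by_contra! hD
  have key : ∀ (p : List E) (hp : p ≠ []), p.IsChain (fun d e => N.tail e = N.head d) →
      (∀ e ∈ p, e ∉ D) → N.head (p.getLast hp) = t → p.head hp ∈ S := by
    intro p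
    induction p with
    | nil => intro hp; exact absurd rfl hp
    | cons a l ih =>
      intro _ hc hD hlast
      have ha := hD a (by simp)
      rcases l with _ | ⟨b, l⟩
      · simpa [ha] using h.head a hlast
      · rw [List.isChain_cons_cons] at hc
        have hb : b ∈ S := ih (by simp) hc.2 (fun e he => hD e (by simp [he]))
          (by simpa using hlast)
        simpa [ha] using h.adj b hb a hc.1.symm
  exact hs _ (key p hp hc hD hlast) hhead

variable [Fintype E]

/-! ### The transfer map of a code -/

section Transfer

variable {F : Type*} [Field F] {w : ℕ} (k : N.Code F w)

/-- The symbols carried by all channels when the vector `x` of messages (on `Fin w`) and errors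
(on `E`) is fed into the network. -/
noncomputable def transfer (x : Fin w ⊕ E → F) (d : Fin w ⊕ E) : F := x ⬝ᵥ N.extKernel k d

theorem transfer_inl (x : Fin w ⊕ E → F) (i : Fin w) :
    N.transfer k x (Sum.inl i) = x (Sum.inl i) := by
  simp [transfer, extKernel]

theorem transfer_inr (x : Fin w ⊕ E → F) (e : E) :
    N.transfer k x (Sum.inr e) =
      ∑ d ∈ N.inChannels w (N.tail e), k d e * N.transfer k x d + x (Sum.inr e) := by
  simp [transfer, extKernel_inr, dotProduct_sum]

theorem vecMul_decodingMatrix (x : Fin w ⊕ E → F) (t : V) (e : {e : E // N.head e = t}) :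
    Matrix.vecMul x (N.decodingMatrix k t) e = N.transfer k x (Sum.inr e.1) := rfl

theorem inr_mem_inChannels {c e : E} :
    (Sum.inr c : Fin w ⊕ E) ∈ N.inChannels w (N.tail e) ↔ N.Adj c e := by
  simp [inChannels, Adj]

theorem inl_mem_inChannels {i : Fin w} {e : E} :
    (Sum.inl i : Fin w ⊕ E) ∈ N.inChannels w (N.tail e) ↔ N.tail e = N.source := by
  simp [inChannels]

/-- The recursion along the network has a unique solution. -/
theorem eq_transfer {x y : Fin w ⊕ E → F} (hl : ∀ i, y (Sum.inl i) = x (Sum.inl i))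
    (hr : ∀ e, y (Sum.inr e) =
      ∑ d ∈ N.inChannels w (N.tail e), k d e * y d + x (Sum.inr e)) :
    y = N.transfer k x := by
  have key : ∀ e, y (Sum.inr e) = N.transfer k x (Sum.inr e) := by
    intro e
    induction e using N.adj_wellFounded.induction with
    | _ e ih =>
      rw [hr, transfer_inr]
      congr 1
      refine Finset.sum_congr rfl fun d hd => ?_
      rcases d with i | c
      · rw [hl, transfer_inl]
      · rw [ih c (N.inr_mem_inChannels.1 hd)]
  funext d
  rcases d with i | e
  · rw [hl, transfer_inl]
  · exact key e

theorem eq_zero_of_transfer_eq_zero {x : Fin w ⊕ E → F} (h : N.transfer k x = 0) : x = 0 := by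
  funext d
  rcases d with i | e
  · rw [← N.transfer_inl k x i, h]
  · have := N.transfer_inr k x e
    simpa [h] using this.symm

end Transfer

/-! ### Barriers and error spaces -/

variable {N} {t : V} {ρ D S : Finset E}

/-- Errors on `ρ` can be replaced by errors on `D`.  The new symbols agree with the old ones on
`D ∪ S` and follow the code elsewhere; they are produced by the code whose coefficients
into `D ∪ S` are erased. -/
theorem IsBarrier.dominated (h : N.IsBarrier t ρ D S) (F : Type*) [Field F] (w : ℕ) :
    N.Dominated F w t ρ D := by
  rintro k _ ⟨Z, hZ, rfl⟩
  set y := N.transfer k (Sum.elim (0 : Fin w → F) Z) with hy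
  let k' : N.Code F w := fun d e => if e ∈ D ∪ S then 0 else k d e
  let x' : Fin w ⊕ E → F :=
    Sum.elim (0 : Fin w → F) fun e => if e ∈ D ∪ S then y (Sum.inr e) else 0
  set y' := N.transfer k' x' with hy'
  have hin : ∀ e ∈ D ∪ S, y' (Sum.inr e) = y (Sum.inr e) := by
    intro e he
    rw [hy', transfer_inr, Finset.sum_eq_zero fun d _ => by simp only [k', if_pos he, zero_mul]]
    simp only [x', Sum.elim_inr, if_pos he, zero_add]
  have hout : ∀ e, e ∉ D ∪ S → y' (Sum.inr e) =
      ∑ d ∈ N.inChannels w (N.tail e), k d e * y' d := by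
    intro e he
    rw [hy', transfer_inr]
    simp only [x', k', Sum.elim_inr, if_neg he, add_zero]
  have hl : ∀ i, y' (Sum.inl i) = 0 := fun i => by rw [hy', transfer_inl]; rfl
  let Z' : E → F := fun e =>
    y' (Sum.inr e) - ∑ d ∈ N.inChannels w (N.tail e), k d e * y' d
  have heq : y' = N.transfer k (Sum.elim (0 : Fin w → F) Z') :=
    N.eq_transfer k hl fun e => by simp [Z']
  refine ⟨Z', fun e he => ?_, ?_⟩
  · by_cases heS : e ∈ S
    · have h1 := N.transfer_inr k (Sum.elim (0 : Fin w → F) Z) e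
      rw [Sum.elim_inr, hZ e (Finset.disjoint_left.1 h.disjoint heS), add_zero, ← hy] at h1
      simp only [Z']
      rw [hin e (Finset.mem_union_right _ heS), h1, sub_eq_zero]
      refine Finset.sum_congr rfl fun d hd => ?_
      rcases d with i | c
      · rw [hl, hy, transfer_inl]; rfl
      · rw [hin c (h.adj e heS c (N.inr_mem_inChannels.1 hd))]
    · simp only [Z']
      rw [hout e (by simp [he, heS]), sub_self]
  · funext e
    rw [vecMul_decodingMatrix, vecMul_decodingMatrix, ← heq, hin _ (h.head _ e.2)]

theorem IsBarrier.patternRank_le (h : N.IsBarrier t ρ D S) (F : Type*) [Field F] (w : ℕ) :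
    N.patternRank F w t ρ ≤ D.card :=
  Nat.sInf_le ⟨D, h.dominated F w, rfl⟩

/-! ### Linkages -/

variable (N) in
/-- `φ` encodes channel-disjoint paths to `t` which start at the members of `A`, one for each.
Off `A`, `φ` sends a channel to its predecessor on the path through it, or to itself if there is
none; it sends the members of `A` to the last channels of the paths (in some order).  As the network
is acyclic, every injective `φ` of this kind comes from such paths. -/
structure IsLinkage (w : ℕ) (t : V) (A : Finset (Fin w ⊕ E)) (φ : Fin w ⊕ E → Fin w ⊕ E) :
    Prop where
  injective : Function.Injective φ
  of_mem : ∀ a ∈ A, ∃ e, φ a = Sum.inr e ∧ N.head e = t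
  of_notMem : ∀ v ∉ A, φ v = v ∨ ∃ e, v = Sum.inr e ∧ φ v ∈ N.inChannels w (N.tail e)

/-- Menger's theorem, from Hall's: a set `s` of channels that violates the marriage condition has
the neighbourhood `D ∪ S` with `S = s \ A`, and then fewer than `|A|` channels `D` separate `A`
from `t`. -/
theorem exists_isLinkage {w : ℕ} {A : Finset (Fin w ⊕ E)}
    (hA : ∀ D S : Finset (Fin w ⊕ E), Disjoint S A → (∀ e, N.head e = t → Sum.inr e ∈ D ∪ S) →
      (∀ e, Sum.inr e ∈ S → N.inChannels w (N.tail e) ⊆ D ∪ S) → A.card ≤ D.card) :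
    ∃ φ, N.IsLinkage w t A φ := by
  let nb : Fin w ⊕ E → Finset (Fin w ⊕ E) := fun v =>
    if v ∈ A then Finset.univ.filter fun b => ∃ e, b = Sum.inr e ∧ N.head e = t
    else insert v (Finset.univ.filter fun d => ∃ e, v = Sum.inr e ∧ d ∈ N.inChannels w (N.tail e))
  obtain ⟨φ, hφ, hmem⟩ := (Finset.all_card_le_biUnion_card_iff_exists_injective nb).1 (by
    intro s
    set S := s \ A with hS
    have hSsub : S ⊆ s.biUnion nb := by
      intro v hv
      obtain ⟨hvs, hvA⟩ := Finset.mem_sdiff.1 hv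
      exact Finset.mem_biUnion.2 ⟨v, hvs, by simp [nb, hvA]⟩
    by_cases hsA : Disjoint s A
    · exact Finset.card_le_card (by rwa [hS, Finset.sdiff_eq_self_of_disjoint hsA] at hSsub)
    · obtain ⟨a, has, haA⟩ := Finset.not_disjoint_iff.1 hsA
      have hD := hA (s.biUnion nb \ S) S Finset.sdiff_disjoint
        (by
          intro e he
          rw [Finset.sdiff_union_of_subset hSsub]
          exact Finset.mem_biUnion.2 ⟨a, has, by simp [nb, haA, he]⟩)
        (by
          intro e he d hd
          rw [Finset.sdiff_union_of_subset hSsub]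
          obtain ⟨hes, heA⟩ := Finset.mem_sdiff.1 he
          exact Finset.mem_biUnion.2 ⟨_, hes, by simp [nb, heA, hd]⟩)
      have h1 := Finset.card_sdiff_add_card_eq_card hSsub
      have h2 : s.card ≤ S.card + A.card := by
        have := Finset.card_le_card_sdiff_add_card (s := s) (t := A)
        simpa [hS] using this
      omega)
  refine ⟨φ, hφ, fun a ha => ?_, fun v hv => ?_⟩
  · simpa [nb, ha] using hmem a
  · simpa [nb, hv] using hmem v

/-- An error pattern `ρ` of full rank and `w` messages have disjoint paths to `t`, as long
as `w + |ρ|` does not exceed the minimum cut.  The rank may refer to another rate `w'`. -/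
theorem exists_isLinkage_univ_disjSum {F : Type*} [Field F] {w w' : ℕ}
    (hρ : ρ.card ≤ N.patternRank F w' t ρ) (hw : w + ρ.card ≤ N.minCut t) :
    ∃ φ, N.IsLinkage w t (Finset.univ.disjSum ρ) φ := by
  refine exists_isLinkage fun D S hdisj hhead hadj => ?_
  have hSl : ∀ i, Sum.inl i ∉ S := fun i hi =>
    Finset.disjoint_left.1 hdisj hi (by simp)
  have hb : N.IsBarrier t ρ D.toRight S.toRight := by
    refine ⟨?_, fun e he => by simpa using hhead e he, fun e he d hd => ?_⟩
    · rw [Finset.disjoint_left]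
      intro e he heρ
      exact Finset.disjoint_left.1 hdisj (Finset.mem_toRight.1 he) (by simpa using heρ)
    · simpa using hadj e (Finset.mem_toRight.1 he) (N.inr_mem_inChannels.2 hd)
  have hcard := Finset.card_toLeft_add_card_toRight (u := D)
  have htarget : (Finset.univ.disjSum ρ : Finset (Fin w ⊕ E)).card = w + ρ.card := by simp
  rw [htarget]
  by_cases hDl : ∀ i, Sum.inl i ∈ D
  · have : D.toLeft = Finset.univ := Finset.eq_univ_of_forall fun i => by simpa using hDl i
    rw [this, Finset.card_univ, Fintype.card_fin] at hcard
    have := hb.patternRank_le F w'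
    omega
  · push Not at hDl
    obtain ⟨i, hi⟩ := hDl
    have := hb.minCut_le fun e he hs => by
      have := hadj e (Finset.mem_toRight.1 he) (N.inl_mem_inChannels.2 hs : Sum.inl i ∈ _)
      simp [hi, hSl i] at this
    omega

/-- An error pattern of full rank can be enlarged to a linked one of any size up to the minimum cut.
Take disjoint paths from `ρ` and `b - |ρ|` additional messages; the first channels on the paths of
these messages are the new members. -/
theorem exists_superset_isLinkage {F : Type*} [Field F] {w b : ℕ}
    (hρ : ρ.card ≤ N.patternRank F w t ρ) (hb : ρ.card ≤ b) (hbt : b ≤ N.minCut t) :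
    ∃ ρ', ρ ⊆ ρ' ∧ ρ'.card = b ∧ ∃ φ, N.IsLinkage w t ((∅ : Finset (Fin w)).disjSum ρ') φ := by
  obtain ⟨φ, hφ⟩ := exists_isLinkage_univ_disjSum (w := b - ρ.card) hρ (by omega)
  have hsurj : Function.Surjective φ := Finite.surjective_of_injective hφ.injective
  have hl : ∀ i : Fin (b - ρ.card), ∃ e, φ (Sum.inl i) = Sum.inr e ∧ N.head e = t :=
    fun i => hφ.of_mem _ (by simp)
  have hρm : ∀ e ∈ ρ, ∃ c, φ (Sum.inr e) = Sum.inr c ∧ N.head c = t :=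
    fun e he => hφ.of_mem _ (by simpa using he)
  choose g hg hgt using hl
  -- `first i` is the channel that follows the additional message `i` on its path.
  have hfirst : ∀ i : Fin (b - ρ.card), ∃ e, φ (Sum.inr e) = Sum.inl i := by
    intro i
    obtain ⟨j | e, hv⟩ := hsurj (Sum.inl i)
    · rw [hg] at hv; cases hv
    · exact ⟨e, hv⟩
  choose first hfirst using hfirst
  have hinj : Function.Injective first := fun i j hij => by
    have := (hfirst i).symm.trans ((congrArg (φ ∘ Sum.inr) hij).trans (hfirst j))
    exact Sum.inl.inj this
  have hdisj : Disjoint ρ (Finset.univ.map ⟨first, hinj⟩) := by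
    rw [Finset.disjoint_left]
    intro e he hm
    obtain ⟨i, -, rfl⟩ := Finset.mem_map.1 hm
    obtain ⟨c, hc, -⟩ := hρm _ he
    have := hc.symm.trans (hfirst i)
    cases this
  refine ⟨ρ ∪ Finset.univ.map ⟨first, hinj⟩, Finset.subset_union_left, ?_, ?_⟩
  · rw [Finset.card_union_of_disjoint hdisj, Finset.card_map, Finset.card_univ, Fintype.card_fin]
    omega
  -- Bypass the additional messages: `first i` inherits the last channel assigned to `i`.
  let ψ : E → E := fun e => Sum.elim g id (φ (Sum.inr e))
  have hψl : ∀ i, ψ (first i) = g i := fun i => by simp [ψ, hfirst]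
  have hψ : ∀ e c, φ (Sum.inr e) = Sum.inr c → ψ e = c := fun e c h => by simp [ψ, h]
  have hψinj : Function.Injective ψ := by
    intro e e' h
    rcases he : φ (Sum.inr e) with i | c <;> rcases he' : φ (Sum.inr e') with i' | c' <;>
      simp only [ψ, he, he', Sum.elim_inl, Sum.elim_inr, id] at h
    · have : φ (Sum.inl i) = φ (Sum.inl i') := by rw [hg, hg, h]
      rw [hφ.injective this, ← he'] at he
      exact Sum.inr.inj (hφ.injective he)
    · rw [← h, ← hg i] at he'
      cases hφ.injective he'
    · rw [h, ← hg i'] at he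
      cases hφ.injective he
    · rw [h, ← he'] at he
      exact Sum.inr.inj (hφ.injective he)
  refine ⟨Sum.map id ψ, Function.Injective.sumMap Function.injective_id hψinj, ?_, ?_⟩
  · rintro (i | e) he
    · simp at he
    · rcases Finset.mem_union.1 (Finset.inr_mem_disjSum.1 he) with he | he
      · obtain ⟨c, hc, hct⟩ := hρm e he
        exact ⟨c, by simp [hψ e c hc], hct⟩
      · obtain ⟨i, -, rfl⟩ := Finset.mem_map.1 he
        exact ⟨g i, by simp [hψl], hgt i⟩
  · rintro (i | e) he
    · exact Or.inl rfl
    · simp only [Finset.inr_mem_disjSum, Finset.mem_union, not_or] at he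
      rcases hc : φ (Sum.inr e) with i | c
      · refine absurd ?_ he.2
        have : e = first i := Sum.inr.inj (hφ.injective (hc.trans (hfirst i).symm))
        exact Finset.mem_map.2 ⟨i, Finset.mem_univ _, this.symm⟩
      · rcases hφ.of_notMem (Sum.inr e) (by simpa using he.1) with h | ⟨e', he', h⟩
        · left
          rw [hc] at h
          simp [hψ e c hc, Sum.inr.inj h]
        · right
          cases he'
          refine ⟨e, rfl, ?_⟩
          rw [hc, inr_mem_inChannels] at h
          simpa [hψ e c hc, inr_mem_inChannels] using h

/-! ### Codes that realize linkages -/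

section Realize

variable {F : Type*} [Field F] {w : ℕ}

/-- The invariant of the code construction, when `P` is the set of channels whose coefficients have
been chosen: a vector that obeys the code at every channel of `P` outside `A`, and vanishes at
`φ v` for all other `v`, is zero.  For `P = ∅` it holds because `φ` is surjective; for
`P = univ` it says that the symbols received from `A` at the ends of the paths determine the
input. -/
def Realizes (k : N.Code F w) (A : Finset (Fin w ⊕ E)) (φ : Fin w ⊕ E → Fin w ⊕ E)
    (P : Finset E) : Prop :=
  ∀ y : Fin w ⊕ E → F,
    (∀ e ∈ P, Sum.inr e ∉ A → y (Sum.inr e) = ∑ d ∈ N.inChannels w (N.tail e), k d e * y d) →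
    (∀ v, (∀ e ∈ P, v = Sum.inr e → v ∈ A) → y (φ v) = 0) → y = 0

theorem Realizes.congr {k k' : N.Code F w} {A : Finset (Fin w ⊕ E)} {φ : Fin w ⊕ E → Fin w ⊕ E}
    {P : Finset E} (h : Realizes k A φ P) (hk : ∀ e ∈ P, ∀ d, k' d e = k d e) :
    Realizes k' A φ P := fun y h1 h2 => h y (fun e he heA => by
      rw [h1 e he heA]
      exact Finset.sum_congr rfl fun d _ => by rw [hk e he]) h2

/-- When a channel `e`, all of whose predecessors lie in `P`, is added to `P`, the coefficients into
`e` have to avoid at most one hyperplane, the kernel of `f`, to preserve the invariant.  Indeed the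
vectors that satisfy every condition except the one at `e` form at most a line, spanned by some
`y` with `y (φ e) ≠ 0`, and the new condition has to fail at `y`.  Restricting `y` to `P` and its
complement shows: if `φ e = e`, then `y` vanishes on `P`, and no choice of coefficients does harm;
if `φ e` is a predecessor of `e`, then `y e = 0`, and the condition on the coefficients is linear
and not void. -/
theorem Realizes.exists_functional {k : N.Code F w} {A : Finset (Fin w ⊕ E)}
    {φ : Fin w ⊕ E → Fin w ⊕ E} {P : Finset E} (h : Realizes k A φ P) (hφ : N.IsLinkage w t A φ)
    {e : E} (heP : e ∉ P) (hP : ∀ c ∈ insert e P, ∀ d, N.Adj d c → d ∈ P) :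
    ∃ f : (Fin w ⊕ E → F) →ₗ[F] F, f ≠ 0 ∧ ∀ k' : N.Code F w,
      (∀ c ∈ P, ∀ d, k' d c = k d c) → f (fun d => k' d e) ≠ 0 →
        Realizes k' A φ (insert e P) := by
  have hone : ∃ f : (Fin w ⊕ E → F) →ₗ[F] F, f ≠ 0 := by
    refine ⟨LinearMap.proj (Sum.inr e), fun h0 => ?_⟩
    have := LinearMap.congr_fun h0 (fun _ => 1)
    simp at this
  by_cases heA : Sum.inr e ∈ A
  · obtain ⟨f, hf⟩ := hone
    refine ⟨f, hf, fun k' hk' _ y h1 h2 => h.congr hk' y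
      (fun c hc => h1 c (Finset.mem_insert_of_mem hc)) fun v hv => h2 v fun c hc hvc => ?_⟩
    rcases Finset.mem_insert.1 hc with rfl | hc
    · rwa [hvc]
    · exact hv c hc hvc
  -- `W y`: the vector `y` satisfies all conditions except the one at `e`.
  let W : (Fin w ⊕ E → F) → Prop := fun y =>
    (∀ c ∈ P, Sum.inr c ∉ A → y (Sum.inr c) = ∑ d ∈ N.inChannels w (N.tail c), k d c * y d) ∧
    (∀ v, (∀ c ∈ insert e P, v = Sum.inr c → v ∈ A) → y (φ v) = 0)
  have hWe : ∀ y, W y → y (φ (Sum.inr e)) = 0 → y = 0 := by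
    rintro y ⟨h1, h2⟩ h0
    refine h y h1 fun v hv => ?_
    by_cases hve : v = Sum.inr e
    · rw [hve, h0]
    · refine h2 v fun c hc hvc => ?_
      rcases Finset.mem_insert.1 hc with rfl | hc
      · exact absurd hvc hve
      · exact hv c hc hvc
  -- The invariant passes to `insert e P` if the condition at `e` excludes all nonzero `y` with `W y`.
  have hreal : ∀ k' : N.Code F w, (∀ c ∈ P, ∀ d, k' d c = k d c) →
      (∀ y, W y → y (Sum.inr e) = ∑ d ∈ N.inChannels w (N.tail e), k' d e * y d → y = 0) →
      Realizes k' A φ (insert e P) := by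
    intro k' hk' hW y h1 h2
    refine hW y ⟨fun c hc hcA => ?_, h2⟩ (h1 e (Finset.mem_insert_self _ _) heA)
    rw [h1 c (Finset.mem_insert_of_mem hc) hcA]
    exact Finset.sum_congr rfl fun d _ => by rw [hk' c hc]
  by_cases hW0 : ∀ y, W y → y = 0
  · obtain ⟨f, hf⟩ := hone
    exact ⟨f, hf, fun k' hk' _ => hreal k' hk' fun y hy _ => hW0 y hy⟩
  push Not at hW0
  obtain ⟨y, hy, hy0⟩ := hW0
  have hye : y (φ (Sum.inr e)) ≠ 0 := fun h0 => hy0 (hWe y hy h0)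
  have hline : ∀ z, W z → z = (z (φ (Sum.inr e)) / y (φ (Sum.inr e))) • y := by
    intro z hz
    rw [← sub_eq_zero]
    refine hWe _ ⟨fun c hc hcA => ?_, fun v hv => ?_⟩ ?_
    · simp only [Pi.sub_apply, Pi.smul_apply, smul_eq_mul]
      rw [hz.1 c hc hcA, hy.1 c hc hcA, Finset.mul_sum, ← Finset.sum_sub_distrib]
      exact Finset.sum_congr rfl fun d _ => by ring
    · simp [hz.2 v hv, hy.2 v hv]
    · simp [div_mul_cancel₀ _ hye]
  have hfin : ∀ k' : N.Code F w, (∀ c ∈ P, ∀ d, k' d c = k d c) →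
      y (Sum.inr e) ≠ ∑ d ∈ N.inChannels w (N.tail e), k' d e * y d →
      Realizes k' A φ (insert e P) := by
    refine fun k' hk' hne => hreal k' hk' fun z hz hze => ?_
    let r := z (φ (Sum.inr e)) / y (φ (Sum.inr e))
    have hzr : z = r • y := hline z hz
    have hr0 : r = 0 := by
      by_contra hr0
      refine hne (mul_left_cancel₀ hr0 ?_)
      rw [hzr] at hze
      simp only [Pi.smul_apply, smul_eq_mul] at hze
      rw [hze, Finset.mul_sum]
      exact Finset.sum_congr rfl fun d _ => by ring
    rw [hzr, hr0, zero_smul]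
  -- The processed part: the messages and the channels in `P`.
  let Q : Fin w ⊕ E → Prop := Sum.elim (fun _ => True) (· ∈ P)
  have hQ : ∀ c ∈ insert e P, ∀ d ∈ N.inChannels w (N.tail c), Q d := by
    rintro c hc (i | d) hd
    · trivial
    · exact hP c hc d (N.inr_mem_inChannels.1 hd)
  rcases hφ.of_notMem _ heA with hfix | ⟨e', he', hpred⟩
  · have hyP : ∀ d, Q d → y d = 0 := by
      have : (fun d => if Q d then y d else 0) = 0 := by
        refine hWe _ ⟨fun c hc hcA => ?_, fun v hv => ?_⟩ ?_
        · beta_reduce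
          rw [if_pos (show Q (Sum.inr c) from hc), hy.1 c hc hcA]
          exact Finset.sum_congr rfl fun d hd =>
            by rw [if_pos (hQ c (Finset.mem_insert_of_mem hc) d hd)]
        · simp only [hy.2 v hv, ite_self]
        · rw [hfix, if_neg (show ¬ Q (Sum.inr e) from heP)]
      intro d hd
      simpa [hd] using congrFun this d
    obtain ⟨f, hf⟩ := hone
    refine ⟨f, hf, fun k' hk' _ => hfin k' hk' ?_⟩
    rw [Finset.sum_eq_zero fun d hd =>
      by rw [hyP d (hQ e (Finset.mem_insert_self _ _) d hd), mul_zero]]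
    rwa [hfix] at hye
  · cases he'
    have hye0 : y (Sum.inr e) = 0 := by
      have : (fun d => if Q d then 0 else y d) = 0 := by
        refine hWe _ ⟨fun c hc hcA => ?_, fun v hv => ?_⟩ ?_
        · beta_reduce
          rw [if_pos (show Q (Sum.inr c) from hc)]
          exact (Finset.sum_eq_zero fun d hd =>
            by rw [if_pos (hQ c (Finset.mem_insert_of_mem hc) d hd), mul_zero]).symm
        · simp only [hy.2 v hv, ite_self]
        · rw [if_pos (hQ e (Finset.mem_insert_self _ _) _ hpred)]
      simpa [show ¬ Q (Sum.inr e) from heP] using congrFun this (Sum.inr e)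
    refine ⟨∑ d ∈ N.inChannels w (N.tail e), y d • LinearMap.proj d, fun h0 => hye ?_,
      fun k' hk' hne => hfin k' hk' ?_⟩
    · have := LinearMap.congr_fun h0 (Pi.single (φ (Sum.inr e)) 1)
      simpa [LinearMap.sum_apply, Pi.single_apply, hpred] using this
    · rw [hye0]
      intro h0
      apply hne
      rw [h0]
      simp [LinearMap.sum_apply, mul_comm]

/-- At most `|F|` linkages can be realized by one code over `F`.  The coefficients are chosen one
channel at a time, along the network; each linkage excludes at most one hyperplane at each step. -/
theorem exists_code_realizes {ι : Type*} (s : Finset ι) (t : ι → V)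
    (A : ι → Finset (Fin w ⊕ E)) (φ : ι → Fin w ⊕ E → Fin w ⊕ E)
    (hφ : ∀ i ∈ s, N.IsLinkage w (t i) (A i) (φ i)) (hs : (s.card : ℕ∞) ≤ ENat.card F) :
    ∃ k : N.Code F w, ∀ i ∈ s, Realizes k (A i) (φ i) Finset.univ := by
  have key : ∀ n ≤ Fintype.card E, ∃ P : Finset E, P.card = n ∧
      (∀ c ∈ P, ∀ d, N.Adj d c → d ∈ P) ∧
      ∃ k : N.Code F w, ∀ i ∈ s, Realizes k (A i) (φ i) P := by
    intro n
    induction n with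
    | zero =>
      refine fun _ => ⟨∅, rfl, by simp, 0, fun i hi y _ h2 => ?_⟩
      funext d
      obtain ⟨v, rfl⟩ := Finite.surjective_of_injective (hφ i hi).injective d
      exact h2 v (by simp)
    | succ n ih =>
      intro hn
      obtain ⟨P, hPn, hP, k, hk⟩ := ih (by omega)
      have hne : {e | e ∉ P}.Nonempty := by
        by_contra hemp
        have : P = Finset.univ := Finset.eq_univ_of_forall fun e => by
          by_contra he
          exact hemp ⟨e, he⟩
        rw [this, Finset.card_univ] at hPn
        omega
      obtain ⟨e, heP : e ∉ P, hmin⟩ := N.adj_wellFounded.has_min _ hne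
      have hP' : ∀ c ∈ insert e P, ∀ d, N.Adj d c → d ∈ P := by
        intro c hc d hd
        rcases Finset.mem_insert.1 hc with rfl | hc
        · by_contra hdP
          exact hmin d hdP hd
        · exact hP c hc d hd
      have hex : ∀ i : s, ∃ f : (Fin w ⊕ E → F) →ₗ[F] F, f ≠ 0 ∧ ∀ k' : N.Code F w,
          (∀ c ∈ P, ∀ d, k' d c = k d c) → f (fun d => k' d e) ≠ 0 →
            Realizes k' (A i) (φ i) (insert e P) :=
        fun i => (hk i i.2).exists_functional (hφ i i.2) heP hP'
      choose f hf hfk using hex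
      obtain ⟨x, hx⟩ := exists_forall_apply_ne_zero s.attach f (fun i _ => hf i)
        (by rwa [Finset.card_attach])
      refine ⟨insert e P, by rw [Finset.card_insert_of_notMem heP, hPn],
        fun c hc d hd => Finset.mem_insert_of_mem (hP' c hc d hd),
        fun d c => if c = e then x d else k d c, fun i hi => ?_⟩
      refine hfk ⟨i, hi⟩ _ (fun c hc d => if_neg fun (h : c = e) => heP (h ▸ hc)) ?_
      simpa using hx ⟨i, hi⟩ (Finset.mem_attach _ _)
  obtain ⟨P, hP, -, k, hk⟩ := key _ le_rfl
  rw [Finset.card_eq_iff_eq_univ] at hP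
  exact ⟨k, fun i hi => hP ▸ hk i hi⟩

/-- If a code realizes a linkage from `A` to `t`, then an input supported on `A` can be recovered
from the symbols received at `t`: the vector of all symbols obeys the code off `A`. -/
theorem Realizes.eq_zero {k : N.Code F w} {A : Finset (Fin w ⊕ E)} {φ : Fin w ⊕ E → Fin w ⊕ E}
    (h : Realizes k A φ Finset.univ) (hφ : N.IsLinkage w t A φ) {x : Fin w ⊕ E → F}
    (hx : ∀ d ∉ A, x d = 0) (h0 : Matrix.vecMul x (N.decodingMatrix k t) = 0) : x = 0 := by
  refine N.eq_zero_of_transfer_eq_zero k (h _ (fun e _ he => ?_) fun v hv => ?_)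
  · rw [transfer_inr, hx _ he, add_zero]
  · by_cases hvA : v ∈ A
    · obtain ⟨e, he, het⟩ := hφ.of_mem v hvA
      rw [he]
      exact congrFun h0 ⟨e, het⟩
    · rcases v with i | e
      · rcases hφ.of_notMem _ hvA with h1 | ⟨e, h1, -⟩
        · rw [h1, transfer_inl, hx _ hvA]
        · cases h1
      · exact absurd (hv e (Finset.mem_univ _) rfl) hvA

end Realize

/-! ### The rank of an error pattern -/

section Rank

variable {F : Type*} [Field F] {w : ℕ}

theorem Dominated.trans {ρ₁ ρ₂ ρ₃ : Finset E} (h₁ : N.Dominated F w t ρ₁ ρ₂)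
    (h₂ : N.Dominated F w t ρ₂ ρ₃) : N.Dominated F w t ρ₁ ρ₃ := fun k => (h₁ k).trans (h₂ k)

theorem errorSpace_mono (k : N.Code F w) (t : V) {ρ ρ' : Finset E} (h : ρ ⊆ ρ') :
    N.errorSpace k t ρ ≤ N.errorSpace k t ρ' := by
  rintro _ ⟨Z, hZ, rfl⟩
  exact ⟨Z, fun e he => hZ e fun h' => he (h h'), rfl⟩

variable (N t ρ F w) in
theorem patternRank_le_card : N.patternRank F w t ρ ≤ ρ.card :=
  Nat.sInf_le ⟨ρ, fun _ => le_rfl, rfl⟩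

variable (N t ρ F w) in
theorem exists_dominated_card_eq_patternRank :
    ∃ ρ', N.Dominated F w t ρ ρ' ∧ ρ'.card = N.patternRank F w t ρ :=
  Nat.sInf_mem (s := {n | ∃ ρ', N.Dominated F w t ρ ρ' ∧ ρ'.card = n})
    ⟨_, ρ, fun _ => le_rfl, rfl⟩

/-- The linear map `(Z e)_{e ∈ ρ} ↦ (0, Z) * decodingMatrix t`, whose range is `Δ(t, ρ)`. -/
noncomputable def errorMap (k : N.Code F w) (t : V) (ρ : Finset E) :
    (ρ → F) →ₗ[F] ({e : E // N.head e = t} → F) where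
  toFun Z := Matrix.vecMul
    (Sum.elim (0 : Fin w → F) fun e => if h : e ∈ ρ then Z ⟨e, h⟩ else 0) (N.decodingMatrix k t)
  map_add' X Y := by
    rw [← Matrix.add_vecMul]
    congr 1
    ext (i | e)
    · simp
    · by_cases h : e ∈ ρ <;> simp [h]
  map_smul' c X := by
    rw [← Matrix.smul_vecMul]
    congr 1
    ext (i | e)
    · simp
    · by_cases h : e ∈ ρ <;> simp [h]

theorem range_errorMap (k : N.Code F w) (t : V) (ρ : Finset E) :
    LinearMap.range (errorMap k t ρ) = N.errorSpace k t ρ := by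
  ext y
  constructor
  · rintro ⟨Z, rfl⟩
    exact ⟨_, fun e he => dif_neg he, rfl⟩
  · rintro ⟨Z, hZ, rfl⟩
    refine ⟨fun e => Z e, ?_⟩
    change Matrix.vecMul _ _ = _
    congr 2
    ext e
    by_cases h : e ∈ ρ <;> simp [h, hZ]

theorem finrank_errorSpace_le (k : N.Code F w) (t : V) (ρ : Finset E) :
    Module.finrank F (N.errorSpace k t ρ) ≤ ρ.card := by
  rw [← range_errorMap]
  exact (LinearMap.finrank_range_le _).trans (by simp)

/-- A linked error pattern has full rank: realizing its linkage alone needs no large field, and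
yields a code whose error space has the full dimension. -/
theorem IsLinkage.patternRank_eq {φ : Fin w ⊕ E → Fin w ⊕ E}
    (hφ : N.IsLinkage w t ((∅ : Finset (Fin w)).disjSum ρ) φ) :
    N.patternRank F w t ρ = ρ.card := by
  refine le_antisymm (patternRank_le_card N t ρ F w) ?_
  obtain ⟨k, hk⟩ := exists_code_realizes (F := F) (N := N) (Finset.univ : Finset Unit)
    (fun _ => t) (fun _ => (∅ : Finset (Fin w)).disjSum ρ) (fun _ => φ) (fun _ _ => hφ)
    (by simpa using (ENat.one_le_card_iff_nonempty F).2 inferInstance)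
  have hinj : Function.Injective (errorMap k t ρ) := by
    rw [injective_iff_map_eq_zero]
    intro Z hZ
    have := (hk () (Finset.mem_univ _)).eq_zero hφ
      (by rintro (i | e) he
          · rfl
          · simp only [Finset.inr_mem_disjSum] at he
            exact dif_neg he) hZ
    funext e
    simpa using congrFun this (Sum.inr e)
  obtain ⟨ρ', hdom, hcard⟩ := exists_dominated_card_eq_patternRank N t ρ F w
  calc ρ.card = Module.finrank F (N.errorSpace k t ρ) := by
        rw [← range_errorMap, LinearMap.finrank_range_of_inj hinj]; simp
    _ ≤ Module.finrank F (N.errorSpace k t ρ') := Submodule.finrank_mono (hdom k)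
    _ ≤ N.patternRank F w t ρ := hcard ▸ finrank_errorSpace_le k t ρ'

/-- Domination passes from `ρ` to a `ρ₁` of minimal size, which has full rank and thus extends to a
linked pattern of size `b`. -/
theorem exists_mem_fullRankPatterns {b : ℕ} (hρ : N.patternRank F w t ρ ≤ b)
    (hb : b ≤ N.minCut t) :
    ∃ ρ' ∈ N.fullRankPatterns F w t b, N.Dominated F w t ρ ρ' := by
  obtain ⟨ρ₁, hdom, hcard⟩ := exists_dominated_card_eq_patternRank N t ρ F w
  have hrank : ρ₁.card ≤ N.patternRank F w t ρ₁ := by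
    obtain ⟨ρ₂, hdom₂, hcard₂⟩ := exists_dominated_card_eq_patternRank N t ρ₁ F w
    rw [hcard, ← hcard₂]
    exact Nat.sInf_le ⟨ρ₂, hdom.trans hdom₂, rfl⟩
  obtain ⟨ρ', hsub, hcard', φ, hφ⟩ := exists_superset_isLinkage hrank (hcard ▸ hρ) hb
  refine ⟨ρ', ?_, hdom.trans fun k => errorSpace_mono k t hsub⟩
  simp [fullRankPatterns, hcard', hφ.patternRank_eq (F := F)]

end Rank

end Network

/-! ### Existence of the code -/

theorem mainTheorem3 {V E : Type*} [Finite V] [Fintype E] (N : Network V E)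
    (F : Type*) [Field F] (w : ℕ) (β : V → ℕ)
    (hβ : ∀ t ∈ N.sinks, (β t : ℤ) ≤ N.redundancy w t)
    (hF : ((∑ t ∈ N.sinks, (N.fullRankPatterns F w t (β t)).card : ℕ) : ℕ∞) ≤ ENat.card F) :
    ∃ k : N.Code F w, N.IsRegular k ∧
      ∀ t ∈ N.sinks, (β t : ℕ∞) + 1 ≤ N.minDist k t := by
  have hcut : ∀ t ∈ N.sinks, w + β t ≤ N.minCut t := fun t ht => by
    have := hβ t ht
    simp only [Network.redundancy] at this
    omega
  have hlink : ∀ i : (_ : V) × Finset E, ∃ φ, i.1 ∈ N.sinks →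
      i.2 ∈ N.fullRankPatterns F w i.1 (β i.1) →
        N.IsLinkage w i.1 (Finset.univ.disjSum i.2) φ := by
    rintro ⟨t, ρ⟩
    by_cases h : t ∈ N.sinks ∧ ρ ∈ N.fullRankPatterns F w t (β t)
    · obtain ⟨hcard, hrank⟩ := (Finset.mem_filter.1 h.2).2
      obtain ⟨φ, hφ⟩ := Network.exists_isLinkage_univ_disjSum (w := w)
        (hcard.trans hrank.symm).le (hcard ▸ hcut t h.1)
      exact ⟨φ, fun _ _ => hφ⟩
    · exact ⟨id, fun h1 h2 => absurd ⟨h1, h2⟩ h⟩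
  choose φ hφ using hlink
  obtain ⟨k, hk⟩ := Network.exists_code_realizes (F := F) (N := N)
    (N.sinks.sigma fun t => N.fullRankPatterns F w t (β t)) (fun i => i.1)
    (fun i => Finset.univ.disjSum i.2) φ
    (fun i hi => hφ i (Finset.mem_sigma.1 hi).1 (Finset.mem_sigma.1 hi).2)
    (by rwa [Finset.card_sigma])
  -- Message and error are determined by the received word if the error pattern is in `R_t(β t)`.
  have hzero : ∀ t ∈ N.sinks, ∀ ρ ∈ N.fullRankPatterns F w t (β t), ∀ (X : Fin w → F) (Z : E → F),
      (∀ e ∉ ρ, Z e = 0) → Matrix.vecMul (Sum.elim X Z) (N.decodingMatrix k t) = 0 → X = 0 := by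
    intro t ht ρ hρ X Z hZ h0
    have := (hk ⟨t, ρ⟩ (Finset.mem_sigma.2 ⟨ht, hρ⟩)).eq_zero (hφ ⟨t, ρ⟩ ht hρ)
      (by rintro (i | e) he
          · simp at he
          · exact hZ e (by simpa using he)) h0
    funext i
    exact congrFun this (Sum.inl i)
  refine ⟨k, fun t ht => ?_, fun t ht => le_sInf ?_⟩
  · obtain ⟨ρ, hρ, -⟩ := Network.exists_mem_fullRankPatterns (ρ := ∅) (F := F) (w := w) (b := β t)
      ((Network.patternRank_le_card N t ∅ F w).trans (by simp))
      ((Nat.le_add_left _ _).trans (hcut t ht))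
    let f : (Fin w → F) →ₗ[F] ({e : E // N.head e = t} → F) :=
      { toFun := fun X => Matrix.vecMul (Sum.elim X (0 : E → F)) (N.decodingMatrix k t)
        map_add' := fun X Y => by
          rw [← Matrix.add_vecMul]
          congr 1
          ext (i | i) <;> simp
        map_smul' := fun c X => by
          rw [← Matrix.smul_vecMul]
          congr 1
          ext (i | i) <;> simp }
    have hf : Function.Injective f := by
      rw [injective_iff_map_eq_zero]
      exact fun X hX => hzero t ht ρ hρ X 0 (fun _ _ => rfl) hX
    have hrange : LinearMap.range f = N.messageSpace k t := rfl
    rw [← hrange, LinearMap.finrank_range_of_inj hf]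
    simp
  · rintro _ ⟨ρ, hpos, rfl⟩
    by_contra hlt
    have hle : N.patternRank F w t ρ ≤ β t := by
      rw [not_le] at hlt
      exact_mod_cast Order.lt_add_one_iff.1 (by exact_mod_cast hlt)
    obtain ⟨ρ', hρ', hdom⟩ :=
      Network.exists_mem_fullRankPatterns hle ((Nat.le_add_left _ _).trans (hcut t ht))
    have hbot : N.errorSpace k t ρ ⊓ N.messageSpace k t = ⊥ := by
      rw [eq_bot_iff]
      rintro y ⟨hy, X, hX⟩
      obtain ⟨Z, hZ, hZy⟩ := hdom k hy
      have hX0 : X = 0 := hzero t ht ρ' hρ' X (-Z) (fun e he => by simp [hZ e he]) (by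
        have : Sum.elim X (-Z) = Sum.elim X (0 : E → F) - Sum.elim (0 : Fin w → F) Z := by
          ext (i | e) <;> simp
        rw [this, Matrix.sub_vecMul, hX, hZy, sub_self])
      rw [Submodule.mem_bot, ← hX, hX0]
      simp
    rw [hbot, finrank_bot] at hpos
    exact lt_irrefl 0 hpos
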